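/- Let $N\ge 2$ and $d\ge 2$ be integers and let $(p_n)_{n\ge1}$ be a non-decreasing sequence in $(0,1]$ with $\prod_{n=1}^\infty p_n>0$. Fat fractal percolation is the following random construction. Divide the unit cube $[0,1]^d$ into $N^d$ closed subcubes of side length $N^{-1}$; retain each of them with probability $p_1$ and discard it with probability $1-p_1$. For each $n\ge 2$, divide every cube retained at step $n-1$ into $N^d$ closed subcubes of side length $N^{-n}$ and retain each of these with probability $p_n$, discarding it with probability $1-p_n$; all choices, at all steps, are independent. Let $D_n$ be the union of the cubes retained at step $n$, and let $D=\bigcap_{n\ge1}D_n$ be the limit set. Let $D^{\mathrm{dust}}$ be the dust set, that is, the set of all $x\in D$ whose connected component in $D$ is $\{x\}$, and let $\lambda$ be $d$-dimensional Lebesgue measure. For $n\ge0$, a level-$n$ cube is a cube $c+[0,N^{-n}]^d$ with $c\in\{0,N^{-n},\dots,(N^n-1)N^{-n}\}^d$. (i) If $\prod_{n=1}^\infty p_n^{N^{dn}}=0$, then almost surely $D$ has empty interior. (ii) If $\prod_{n=1}^\infty p_n^{N^{n}}>0$, then $\lambda(D^{\mathrm{dust}})=0$ almost surely. (iii) If $\prod_{n=1}^\infty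 p_n^{N^{dn}}>0$, then almost surely $D$ is the union of a finite (possibly empty) collection of cubes, each of them a level-$n$ cube for some $n\ge0$. -/

import Mathlib

open MeasureTheory Filter Topology

namespace FatFractal

/-- The set `J^d = {0, …, N-1}^d` of positions of the subcubes of side `1/N` in a cube. -/
abbrev Digit (N d : ℕ) : Type := Fin d → Fin N

/-- The set `J^{d,n}` of words of length `n` over `J^d`; they index the level-`n` cubes. -/
abbrev Word (N d n : ℕ) : Type := Fin n → Digit N d

/-- The set `𝒥` of all finite words over `J^d`, of all lengths `n ≥ 0`. -/
abbrev Index (N d : ℕ) : Type := Σ n : ℕ, Word N d n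

/-- The lower corner `c(I)`, with coordinates `∑_{j=1}^n N^{-j} i_{j,t}`. The letter `i_j` is
`I k` with `k = j - 1`. -/
noncomputable def corner {N d n : ℕ} (I : Word N d n) : Fin d → ℝ :=
  fun t => ∑ k : Fin n, (I k t : ℝ) / (N : ℝ) ^ ((k : ℕ) + 1)

/-- The closed level-`n` cube `C(I) = c(I) + [0, N^{-n}]^d`. -/
noncomputable def cube {N d n : ℕ} (I : Word N d n) : Set (Fin d → ℝ) :=
  Set.Icc (corner I) (fun t => corner I t + 1 / (N : ℝ) ^ n)

/-- The first `k` letters of a word of length `n`, where `k < n`. -/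
def initialWord {N d n : ℕ} (I : Word N d n) (k : Fin n) : Word N d (k : ℕ) :=
  fun i => I (Fin.castLE k.isLt.le i)

/-- Configurations: `ω (I, j)` is the value of `Z(I, j)`, with `true` for `1`. -/
abbrev Config (N d : ℕ) : Type := Index N d × Digit N d → Bool

/-- The law on `{0,1}` giving mass `q` to `1` and mass `1 - q` to `0`. -/
noncomputable def coin (q : unitInterval) : Measure Bool :=
  unitInterval.toNNReal q • Measure.dirac true +
    unitInterval.toNNReal (unitInterval.symm q) • Measure.dirac false

instance (q : unitInterval) : IsProbabilityMeasure (coin q) := by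
  unfold coin; infer_instance

/-- The law of fat fractal percolation with retention probabilities `p 1, p 2, …`: the `Z(I, j)`
are independent, and `Z(I, j)` is `1` with probability `p (|I| + 1)`. (`p 0` is not used.) -/
noncomputable def fatLaw (N d : ℕ) (p : ℕ → unitInterval) : Measure (Config N d) :=
  Measure.infinitePi (fun a : Index N d × Digit N d => coin (p (a.1.1 + 1)))

/-- `C(I)` is retained: `Z(i_1) = Z(i_1, i_2) = ⋯ = Z(i_1, …, i_n) = 1`. -/
def Retained {N d n : ℕ} (ω : Config N d) (I : Word N d n) : Prop :=
  ∀ k : Fin n, ω (⟨(k : ℕ), initialWord I k⟩, I k) = true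

/-- `D^n`: the union of the retained closed level-`n` cubes (a finite union, hence closed). -/
def stage {N d : ℕ} (ω : Config N d) (n : ℕ) : Set (Fin d → ℝ) :=
  ⋃ (I : Word N d n) (_ : Retained ω I), cube I

/-- The limit set `D = ⋂_{n ≥ 1} D^n`. -/
def limitSet {N d : ℕ} (ω : Config N d) : Set (Fin d → ℝ) :=
  ⋂ (n : ℕ) (_ : 1 ≤ n), stage ω n

/-- The dust set: the points of the limit set whose connected component in it is a single point. -/
def dust {N d : ℕ} (ω : Config N d) : Set (Fin d → ℝ) :=
  {x ∈ limitSet ω | connectedComponentIn (limitSet ω) x = {x}}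

/-- The infinite product `∏_{n=1}^∞ a n` has the value `L`: the partial products tend to `L`. -/
def InfiniteProductEq (a : ℕ → ℝ) (L : ℝ) : Prop :=
  Tendsto (fun m : ℕ => ∏ n ∈ Finset.Icc 1 m, a n) atTop (𝓝 L)

end FatFractal

/-! All three parts are first-moment arguments on the coins `Z(I, j)`, counting also those below
discarded cubes. A positive product `∏ p_n^{k_n}` makes `∑ k_n (1 - p_n)` finite
(`summable_of_infiniteProductEq_pos`).

For (iii), `k_n = N^{dn}`: the expected number of failed coins is finite, so almost surely only
finitely many fail and `D` equals some `D^m`.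

For (ii), `k_n = N^n`: fix a coordinate direction. A failed level-`n` cube obstructs the lines
through a slab of volume `N^{-n(d-1)}`, so the expected total volume of failed slabs is `∑ N^{dn}
N^{-n(d-1)} (1 - p_n)`, which is finite. Hence almost every `x` has finitely many failed cubes on
its line, and if `x ∈ D` then `D` contains a segment through `x` (`notMem_dust_of_finite`).

For (i), an interior point of `D` yields a cube inside `D`, all of whose descendants must be
retained. This has probability zero for each cube (`tendsto_prod_shift_zero`), and there are
countably many cubes. -/

namespace FatFractal

/-! ### Words, subdivision and the geometry of cubes. -/

/-- The word `(I, j)`, obtained from `I` by appending the letter `j`. -/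
def child {N d n : ℕ} (I : Word N d n) (j : Digit N d) : Word N d (n + 1) :=
  Fin.snoc (α := fun _ => Digit N d) I j

theorem exists_eq_child {N d n : ℕ} (J : Word N d (n + 1)) :
    ∃ (I : Word N d n) (j : Digit N d), J = child I j :=
  ⟨Fin.init (α := fun _ => Digit N d) J, J (Fin.last n), (Fin.snoc_init_self _).symm⟩

theorem corner_child {N d n : ℕ} (I : Word N d n) (j : Digit N d) (t : Fin d) :
    corner (child I j) t = corner I t + (j t : ℝ) / (N : ℝ) ^ (n + 1) := by
  simp [corner, child, Fin.sum_univ_castSucc]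

theorem retained_child {N d n : ℕ} {ω : Config N d} {I : Word N d n} {j : Digit N d} :
    Retained ω (child I j) ↔ Retained ω I ∧ ω (⟨n, I⟩, j) = true := by
  have hcast (k : Fin n) : child I j k.castSucc = I k :=
    Fin.snoc_castSucc (α := fun _ => Digit N d) j I k
  have hlast : child I j (Fin.last n) = j := Fin.snoc_last (α := fun _ => Digit N d) j I
  have hinit (k : Fin n) : initialWord (child I j) k.castSucc = initialWord I k := by
    funext i
    exact hcast (Fin.castLE k.isLt.le i)
  have hinit_last : initialWord (child I j) (Fin.last n) = I := by
    funext i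
    exact hcast i
  constructor
  · intro h
    refine ⟨fun k => ?_, ?_⟩
    · have := h k.castSucc
      rw [hcast, hinit] at this
      exact this
    · have := h (Fin.last n)
      rw [hlast, hinit_last] at this
      exact this
  · rintro ⟨h, h'⟩ k
    induction k using Fin.lastCases with
    | last => rw [hlast, hinit_last]; exact h'
    | cast k => rw [hcast, hinit]; exact h k

theorem mem_cube {N d n : ℕ} {I : Word N d n} {x : Fin d → ℝ} :
    x ∈ cube I ↔ ∀ t, corner I t ≤ x t ∧ x t ≤ corner I t + 1 / (N : ℝ) ^ n := by
  simp only [cube, Set.mem_Icc, Pi.le_def, forall_and]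

theorem mem_stage {N d n : ℕ} {ω : Config N d} {x : Fin d → ℝ} :
    x ∈ stage ω n ↔ ∃ I : Word N d n, Retained ω I ∧ x ∈ cube I := by
  simp [stage]

theorem mem_limitSet {N d : ℕ} {ω : Config N d} {x : Fin d → ℝ} :
    x ∈ limitSet ω ↔ ∀ n, 1 ≤ n → x ∈ stage ω n := by
  simp [limitSet]

theorem digit_bounds {N n : ℕ} (hN : 0 < N) (j : Fin N) :
    0 ≤ (j : ℝ) / (N : ℝ) ^ (n + 1) ∧
      (j : ℝ) / (N : ℝ) ^ (n + 1) + 1 / (N : ℝ) ^ (n + 1) ≤ 1 / (N : ℝ) ^ n := by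
  have hN' : (0 : ℝ) < N := by exact_mod_cast hN
  refine ⟨by positivity, ?_⟩
  have hj : (j : ℝ) + 1 ≤ N := by exact_mod_cast j.isLt
  rw [← add_div, div_le_div_iff₀ (by positivity) (by positivity), pow_succ]
  nlinarith [pow_pos hN' n]

theorem cube_child_subset {N d n : ℕ} (hN : 0 < N) (I : Word N d n) (j : Digit N d) :
    cube (child I j) ⊆ cube I := by
  intro x hx
  rw [mem_cube] at hx ⊢
  intro t
  have := hx t
  rw [corner_child] at this
  have hb := digit_bounds (n := n) hN (j t)
  constructor <;> linarith

theorem exists_digit {N n : ℕ} (hN : 0 < N) {c u : ℝ} (h₁ : c ≤ u)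
    (h₂ : u ≤ c + 1 / (N : ℝ) ^ n) :
    ∃ j : Fin N, c + (j : ℝ) / (N : ℝ) ^ (n + 1) ≤ u ∧
      u ≤ c + (j : ℝ) / (N : ℝ) ^ (n + 1) + 1 / (N : ℝ) ^ (n + 1) := by
  have hN' : (0 : ℝ) < N := by exact_mod_cast hN
  set P : ℝ := (N : ℝ) ^ (n + 1) with hP
  have hP0 : 0 < P := by positivity
  have hv0 : 0 ≤ (u - c) * P := mul_nonneg (by linarith) hP0.le
  have hvN : (u - c) * P ≤ N := by
    have : (1 / (N : ℝ) ^ n) * P = N := by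
      rw [hP, pow_succ]
      field_simp
    calc (u - c) * P ≤ (1 / (N : ℝ) ^ n) * P := by gcongr; linarith
      _ = N := this
  have key (j : ℝ) (hj₁ : j ≤ (u - c) * P) (hj₂ : (u - c) * P ≤ j + 1) :
      c + j / P ≤ u ∧ u ≤ c + j / P + 1 / P := by
    rw [add_assoc, ← add_div]
    rw [← div_le_iff₀ hP0] at hj₁
    rw [← le_div_iff₀ hP0] at hj₂
    constructor <;> linarith
  -- The floor reaches `N` only at the right end of the interval, which belongs to the last closed
  -- subinterval.
  rcases lt_or_ge ⌊(u - c) * P⌋₊ N with h | h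
  · exact ⟨⟨_, h⟩, key _ (Nat.floor_le hv0) (Nat.lt_floor_add_one _).le⟩
  · have h' : (N : ℝ) ≤ (u - c) * P := (Nat.le_floor_iff hv0).1 h
    refine ⟨⟨N - 1, by omega⟩, key _ ?_ ?_⟩ <;> push_cast [Nat.cast_sub hN] <;> linarith

theorem exists_mem_cube_child {N d n : ℕ} (hN : 0 < N) {I : Word N d n} {x : Fin d → ℝ}
    (hx : x ∈ cube I) : ∃ j : Digit N d, x ∈ cube (child I j) := by
  rw [mem_cube] at hx
  choose j hj using fun t => exists_digit hN (hx t).1 (hx t).2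
  refine ⟨j, mem_cube.2 fun t => ?_⟩
  rw [corner_child]
  exact hj t

theorem cube_append_subset {N d m : ℕ} (hN : 0 < N) (I : Word N d m) {k : ℕ} (W : Word N d k) :
    cube (Fin.append I W : Word N d (m + k)) ⊆ cube I := by
  induction k with
  | zero =>
    have : W = Fin.elim0 := Subsingleton.elim _ _
    subst this
    rw [Fin.append_elim0]
    rfl
  | succ k ih =>
    obtain ⟨W, j, rfl⟩ := exists_eq_child W
    have : (Fin.append I (child W j) : Word N d (m + (k + 1))) =
        child (Fin.append I W : Word N d (m + k)) j := Fin.append_snoc I W j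
    rw [this]
    exact (cube_child_subset hN _ _).trans (ih W)

theorem cube_subset_unit {N d n : ℕ} (hN : 0 < N) (I : Word N d n) :
    cube I ⊆ Set.Icc 0 1 := by
  induction n with
  | zero =>
    intro x hx
    rw [mem_cube] at hx
    simp only [corner, Finset.univ_eq_empty, Finset.sum_empty, pow_zero, div_one, zero_add] at hx
    exact ⟨fun t => (hx t).1, fun t => (hx t).2⟩
  | succ n ih =>
    obtain ⟨I, j, rfl⟩ := exists_eq_child I
    exact (cube_child_subset hN I j).trans (ih I)

/-! ### Stages, the limit set and retained descendants. -/

theorem stage_succ_subset {N d : ℕ} (hN : 0 < N) (ω : Config N d) (n : ℕ) :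
    stage ω (n + 1) ⊆ stage ω n := by
  intro x hx
  obtain ⟨J, hJ, hxJ⟩ := mem_stage.1 hx
  obtain ⟨I, j, rfl⟩ := exists_eq_child J
  exact mem_stage.2 ⟨I, (retained_child.1 hJ).1, cube_child_subset hN I j hxJ⟩

theorem stage_antitone {N d : ℕ} (hN : 0 < N) (ω : Config N d) : Antitone (stage ω) :=
  antitone_nat_of_succ_le (stage_succ_subset hN ω)

/-- If no subcube around `y` is discarded below level `m`, a point of `D^m` is in the limit set. -/
theorem mem_limitSet_of_forall_true {N d : ℕ} (hN : 0 < N) {ω : Config N d} {m : ℕ}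
    {y : Fin d → ℝ} (hy : y ∈ stage ω m)
    (h : ∀ n, m ≤ n → ∀ (I : Word N d n) (j : Digit N d), y ∈ cube (child I j) →
      ω (⟨n, I⟩, j) = true) : y ∈ limitSet ω := by
  have key (n : ℕ) (hn : m ≤ n) : y ∈ stage ω n := by
    induction n, hn using Nat.le_induction with
    | base => exact hy
    | succ n hn ih =>
      obtain ⟨I, hI, hyI⟩ := mem_stage.1 ih
      obtain ⟨j, hj⟩ := exists_mem_cube_child hN hyI
      exact mem_stage.2 ⟨child I j, retained_child.2 ⟨hI, h n hn I j hj⟩, hj⟩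
  refine mem_limitSet.2 fun n _ => ?_
  rcases le_total m n with hn | hn
  · exact key n hn
  · exact stage_antitone hN ω hn hy

/-- An interior point of a cube belongs to no other cube of the same level. -/
theorem eq_of_mem_interior_of_mem_cube {N d n : ℕ} (hN : 0 < N) {I J : Word N d n}
    {x : Fin d → ℝ} (hI : ∀ t, corner I t < x t ∧ x t < corner I t + 1 / (N : ℝ) ^ n)
    (hJ : x ∈ cube J) : J = I := by
  induction n with
  | zero => exact Subsingleton.elim _ _
  | succ n ih =>
    obtain ⟨I, i, rfl⟩ := exists_eq_child I
    obtain ⟨J, j, rfl⟩ := exists_eq_child J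
    have hJI : J = I := by
      refine ih (fun t => ?_) (cube_child_subset hN J j hJ)
      have := hI t
      rw [corner_child] at this
      have hb := digit_bounds (n := n) hN (i t)
      constructor <;> linarith
    subst hJI
    congr 1
    funext t
    have h₁ := hI t
    have h₂ := mem_cube.1 hJ t
    rw [corner_child] at h₁ h₂
    have hP : (0 : ℝ) < (N : ℝ) ^ (n + 1) := by positivity
    have a₁ : (i t : ℝ) / (N : ℝ) ^ (n + 1) < ((j t : ℝ) + 1) / (N : ℝ) ^ (n + 1) := by
      rw [add_div]; linarith
    have a₂ : (j t : ℝ) / (N : ℝ) ^ (n + 1) < ((i t : ℝ) + 1) / (N : ℝ) ^ (n + 1) := by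
      rw [add_div]; linarith
    rw [div_lt_div_iff_of_pos_right hP] at a₁ a₂
    norm_cast at a₁ a₂
    exact Fin.ext (by omega)

/-- A cube inside the limit set has only retained descendants. -/
theorem eq_true_of_cube_subset_limitSet {N d m : ℕ} (hN : 0 < N) {ω : Config N d}
    {I : Word N d m} (h : cube I ⊆ limitSet ω) {k : ℕ} (W : Word N d k) (j : Digit N d) :
    ω (⟨m + k, Fin.append I W⟩, j) = true := by
  set J : Word N d (m + k) := Fin.append I W with hJ
  have hP : (0 : ℝ) < 1 / (N : ℝ) ^ (m + k + 1) := by positivity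
  -- The centre of the subcube: closed cubes share faces, so a boundary point could be covered by a
  -- retained neighbour instead.
  let x : Fin d → ℝ := fun t => corner (child J j) t + 1 / (N : ℝ) ^ (m + k + 1) / 2
  have hx : ∀ t, corner (child J j) t < x t ∧
      x t < corner (child J j) t + 1 / (N : ℝ) ^ (m + k + 1) := by
    intro t
    simp only [x]
    constructor <;> linarith
  have hxJ : x ∈ cube (child J j) := mem_cube.2 fun t => ⟨(hx t).1.le, (hx t).2.le⟩
  have hxD := h (cube_append_subset hN I W (cube_child_subset hN J j hxJ))
  obtain ⟨K, hK, hxK⟩ := mem_stage.1 (mem_limitSet.1 hxD (m + k + 1) (by omega))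
  obtain rfl := eq_of_mem_interior_of_mem_cube hN hx hxK
  exact (retained_child.1 hK).2

theorem exists_cube_subset_limitSet {N d : ℕ} (hN : 2 ≤ N) {ω : Config N d}
    (h : (interior (limitSet ω)).Nonempty) : ∃ a : Index N d, cube a.2 ⊆ limitSet ω := by
  obtain ⟨x, hx⟩ := h
  obtain ⟨ε, hε, hball⟩ := Metric.isOpen_iff.1 isOpen_interior x hx
  have hN' : (1 : ℝ) < N := by exact_mod_cast hN
  obtain ⟨n, hn⟩ := exists_pow_lt_of_lt_one hε (inv_lt_one_of_one_lt₀ hN')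
  have hn' : 1 / (N : ℝ) ^ (n + 1) < ε := by
    refine lt_of_le_of_lt ?_ hn
    rw [inv_pow, ← one_div]
    exact one_div_le_one_div_of_le (by positivity) (pow_le_pow_right₀ hN'.le (by omega))
  obtain ⟨I, -, hxI⟩ := mem_stage.1 (mem_limitSet.1 (interior_subset hx) (n + 1) (by omega))
  refine ⟨⟨n + 1, I⟩, fun y hy => interior_subset (hball ?_)⟩
  rw [mem_cube] at hxI
  have hy' := mem_cube.1 hy
  rw [Metric.mem_ball, dist_pi_lt_iff hε]
  intro t
  rw [Real.dist_eq, abs_lt]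
  have h₁ := hxI t
  have h₂ := hy' t
  constructor <;> linarith

/-! ### Infinite products and coin probabilities. -/

theorem pow_le_exp_neg {q : ℝ} (hq : 0 ≤ q) (k : ℕ) : q ^ k ≤ Real.exp (-(k * (1 - q))) := by
  have h : q ≤ Real.exp (q - 1) := by linarith [Real.add_one_le_exp (q - 1)]
  calc q ^ k ≤ Real.exp (q - 1) ^ k := pow_le_pow_left₀ hq h k
    _ = Real.exp (-(k * (1 - q))) := by rw [← Real.exp_nat_mul]; ring_nf

/-- A positive infinite product of powers makes the weighted sum of the defects converge. -/
theorem summable_of_infiniteProductEq_pos {p : ℕ → unitInterval} {k : ℕ → ℕ} {L : ℝ}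
    (hL : 0 < L) (h : InfiniteProductEq (fun n => (p n : ℝ) ^ k n) L) :
    Summable (fun n => (k (n + 1) : ℝ) * (1 - p (n + 1))) := by
  have hprod (m : ℕ) : ∏ n ∈ Finset.Icc 1 m, (p n : ℝ) ^ k n =
      ∏ n ∈ Finset.range m, (p (n + 1) : ℝ) ^ k (n + 1) := by
    rw [Finset.range_eq_Ico, Finset.prod_Ico_add' (fun n => (p n : ℝ) ^ k n) 0 m 1]
    rfl
  have hanti : Antitone (fun m => ∏ n ∈ Finset.Icc 1 m, (p n : ℝ) ^ k n) := by
    refine antitone_nat_of_succ_le fun m => ?_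
    rw [hprod, hprod, Finset.prod_range_succ]
    exact mul_le_of_le_one_right
      (Finset.prod_nonneg fun n _ => pow_nonneg (p (n + 1)).2.1 _)
      (pow_le_one₀ (p (m + 1)).2.1 (p (m + 1)).2.2)
  refine summable_of_sum_range_le (c := -Real.log L)
    (fun n => mul_nonneg (Nat.cast_nonneg _) (sub_nonneg.2 (p (n + 1)).2.2)) fun m => ?_
  -- The partial products decrease, so each of them is at least the limit.
  have hle : L ≤ ∏ n ∈ Finset.range m, (p (n + 1) : ℝ) ^ k (n + 1) := by
    rw [← hprod]
    exact hanti.le_of_tendsto h m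
  have hexp : L ≤ Real.exp (-∑ n ∈ Finset.range m, (k (n + 1) : ℝ) * (1 - p (n + 1))) := by
    refine hle.trans ?_
    rw [← Finset.sum_neg_distrib, Real.exp_sum]
    exact Finset.prod_le_prod (fun n _ => pow_nonneg (p (n + 1)).2.1 _)
      fun n _ => pow_le_exp_neg (p (n + 1)).2.1 _
  have := (Real.log_le_iff_le_exp hL).2 hexp
  linarith

theorem coe_toNNReal_eq_ofReal (q : unitInterval) :
    (unitInterval.toNNReal q : ENNReal) = ENNReal.ofReal q := by
  rw [← unitInterval.coe_toNNReal, ENNReal.ofReal_coe_nnreal]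

theorem coin_true (q : unitInterval) : coin q {true} = ENNReal.ofReal q := by
  simp [coin, ENNReal.smul_def, coe_toNNReal_eq_ofReal]

theorem coin_false (q : unitInterval) : coin q {false} = ENNReal.ofReal (1 - q) := by
  simp [coin, ENNReal.smul_def, coe_toNNReal_eq_ofReal]

instance (N d : ℕ) (p : ℕ → unitInterval) : IsProbabilityMeasure (fatLaw N d p) := by
  unfold fatLaw; infer_instance

theorem measurableSet_eq_false {N d : ℕ} (a : Index N d × Digit N d) :
    MeasurableSet {ω : Config N d | ω a = false} :=
  (measurableSet_singleton false).preimage (measurable_pi_apply a)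

theorem fatLaw_eq_false {N d : ℕ} (p : ℕ → unitInterval) (a : Index N d × Digit N d) :
    fatLaw N d p {ω | ω a = false} = ENNReal.ofReal (1 - p (a.1.1 + 1)) := by
  rw [← coin_false]
  exact (measurePreserving_eval_infinitePi
    (fun a : Index N d × Digit N d => coin (p (a.1.1 + 1))) a).measure_preimage
      (measurableSet_singleton false).nullMeasurableSet

theorem fatLaw_forall_eq_true {N d : ℕ} (p : ℕ → unitInterval)
    (s : Finset (Index N d × Digit N d)) :
    fatLaw N d p {ω | ∀ a ∈ s, ω a = true} = ∏ a ∈ s, ENNReal.ofReal (p (a.1.1 + 1)) := by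
  simp_rw [← coin_true]
  exact Measure.infinitePi_pi (fun a : Index N d × Digit N d => coin (p (a.1.1 + 1)))
    (s := s) (t := fun _ => {true}) fun _ _ => measurableSet_singleton true

theorem card_word_mul_digit (N d n : ℕ) :
    Fintype.card (Word N d n) * Fintype.card (Digit N d) = N ^ (d * (n + 1)) := by
  simp only [Fintype.card_pi, Fintype.card_fin, Finset.prod_const, Finset.card_univ]
  rw [← pow_mul, ← pow_add]
  ring

/-- The coin `(I, j)` with `|I| = n` decides a cube of level `n + 1`, and there are `N^{d(n+1)}` of
these. -/
theorem tsum_index_digit (N d : ℕ) (f : ℕ → ENNReal) :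
    ∑' a : Index N d × Digit N d, f (a.1.1 + 1) = ∑' n, (N ^ (d * (n + 1)) : ℕ) * f (n + 1) := by
  rw [ENNReal.tsum_prod', ENNReal.tsum_sigma']
  refine tsum_congr fun n => ?_
  simp only [tsum_fintype, Finset.sum_const, Finset.card_univ, nsmul_eq_mul]
  rw [← card_word_mul_digit, Nat.cast_mul, mul_assoc]

/-! ### Part (iii): finite unions of cubes. -/

/-- If all but finitely many subcubes are retained, the limit set is a finite union of cubes. -/
theorem exists_limitSet_eq_iUnion_cube {N d : ℕ} (hN : 0 < N) {ω : Config N d}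
    (h : {a | ω a = false}.Finite) :
    ∃ S : Finset (Index N d), limitSet ω = ⋃ I ∈ S, cube I.2 := by
  classical
  -- `m` bounds the lengths of the parent words of failed coins, so nothing is discarded after level
  -- `m + 1`.
  obtain ⟨m, hm⟩ := (h.image fun a => a.1.1).bddAbove
  refine ⟨(Finset.univ.filter fun I : Word N d (m + 1) => Retained ω I).map
    ⟨Sigma.mk (m + 1), sigma_mk_injective⟩, ?_⟩
  have hstage : limitSet ω = stage ω (m + 1) := by
    refine Set.Subset.antisymm (fun y hy => mem_limitSet.1 hy (m + 1) (by omega)) fun y hy => ?_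
    refine mem_limitSet_of_forall_true hN hy fun n hn I j _ => ?_
    by_contra hf
    have : n ≤ m := hm ⟨(⟨n, I⟩, j), by simpa using hf, rfl⟩
    omega
  ext y
  simp [hstage, mem_stage]

theorem ae_exists_limitSet_eq_iUnion_cube {N d : ℕ} (hN : 0 < N) {p : ℕ → unitInterval} {L : ℝ}
    (hL : 0 < L) (h : InfiniteProductEq (fun n => (p n : ℝ) ^ (N ^ (d * n))) L) :
    ∀ᵐ ω ∂(fatLaw N d p), ∃ S : Finset (Index N d), limitSet ω = ⋃ I ∈ S, cube I.2 := by
  have hsum : ∑' a : Index N d × Digit N d, fatLaw N d p {ω | ω a = false} ≠ ⊤ := by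
    simp_rw [fatLaw_eq_false]
    rw [tsum_index_digit N d (fun n => ENNReal.ofReal (1 - p n))]
    convert (summable_of_infiniteProductEq_pos hL h).tsum_ofReal_ne_top using 3 with n
    rw [ENNReal.ofReal_mul (Nat.cast_nonneg _), ENNReal.ofReal_natCast]
  -- First Borel–Cantelli lemma.
  filter_upwards [ae_finite_setOfPred_mem hsum] with ω hω
  exact exists_limitSet_eq_iUnion_cube hN hω

/-! ### Part (i): empty interior. -/

/-- Prefixing the index `(W, j)` by the word `I`. -/
def prependIndex {N d m : ℕ} (I : Word N d m) (b : Index N d × Digit N d) :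
    Index N d × Digit N d :=
  (⟨m + b.1.1, Fin.append I b.1.2⟩, b.2)

theorem prependIndex_injective {N d m : ℕ} (I : Word N d m) :
    Function.Injective (prependIndex I) := by
  rintro ⟨⟨k, W⟩, j⟩ ⟨⟨k', W'⟩, j'⟩ h
  simp only [prependIndex, Prod.mk.injEq, Sigma.mk.injEq] at h
  obtain ⟨⟨hk, hW⟩, rfl⟩ := h
  obtain rfl : k = k' := by omega
  have hW' : (Fin.append I W : Word N d (m + k)) = Fin.append I W' := eq_of_heq hW
  have : W = W' := by
    funext i
    simpa using congrFun hW' (Fin.natAdd m i)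
  rw [this]

/-- The probability that the descendants of a word are retained for `M` generations. -/
theorem fatLaw_forall_append_eq_true {N d : ℕ} (p : ℕ → unitInterval) {m : ℕ} (I : Word N d m)
    (M : ℕ) :
    fatLaw N d p {ω | ∀ k < M, ∀ (W : Word N d k) (j : Digit N d),
      ω (⟨m + k, Fin.append I W⟩, j) = true} =
      ∏ k ∈ Finset.range M, ENNReal.ofReal (p (m + k + 1)) ^ (N ^ (d * (k + 1))) := by
  let s : Finset (Index N d × Digit N d) :=
    ((Finset.range M).sigma fun k => (Finset.univ : Finset (Word N d k))) ×ˢ Finset.univ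
  have hset : {ω : Config N d | ∀ k < M, ∀ (W : Word N d k) (j : Digit N d),
      ω (⟨m + k, Fin.append I W⟩, j) = true} =
      {ω | ∀ a ∈ s.map ⟨prependIndex I, prependIndex_injective I⟩, ω a = true} := by
    ext ω
    simp only [Set.mem_ofPred_eq, Finset.forall_mem_map]
    constructor
    · rintro h ⟨⟨k, W⟩, j⟩ hb
      exact h k (by simpa [s] using hb) W j
    · intro h k hk W j
      exact h (⟨k, W⟩, j) (by simpa [s] using hk)
  rw [hset, fatLaw_forall_eq_true, Finset.prod_map, Finset.prod_product, Finset.prod_sigma]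
  refine Finset.prod_congr rfl fun k _ => ?_
  simp only [Function.Embedding.coeFn_mk, prependIndex, Finset.prod_const, Finset.card_univ]
  rw [← pow_mul, mul_comm, card_word_mul_digit]

/-- Below a fixed level-`m` cube the exponents are smaller by the factor `N^{dm}`. The `N^{dm}`-th
power of the shifted product is the tail of the original one, which tends to zero because the head
is positive; hence so does its root. -/
theorem tendsto_prod_shift_zero {N d : ℕ} (hN : 0 < N) {p : ℕ → unitInterval}
    (hpos : ∀ n, 1 ≤ n → 0 < (p n : ℝ))
    (h : InfiniteProductEq (fun n => (p n : ℝ) ^ (N ^ (d * n))) 0) (m : ℕ) :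
    Tendsto (fun M => ∏ k ∈ Finset.range M, (p (m + k + 1) : ℝ) ^ (N ^ (d * (k + 1)))) atTop
      (𝓝 0) := by
  have hK : N ^ (d * m) ≠ 0 := by positivity
  have hprod (M : ℕ) : ∏ n ∈ Finset.Icc 1 (M + m), (p n : ℝ) ^ (N ^ (d * n)) =
      (∏ n ∈ Finset.range m, (p (n + 1) : ℝ) ^ (N ^ (d * (n + 1)))) *
      (∏ k ∈ Finset.range M, (p (m + k + 1) : ℝ) ^ (N ^ (d * (k + 1)))) ^ (N ^ (d * m)) := by
    rw [← Finset.prod_pow]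
    have : Finset.Icc 1 (M + m) = Finset.Ico (0 + 1) (m + M + 1) := by
      ext; simp; omega
    rw [this, ← Finset.prod_Ico_add' (fun n => (p n : ℝ) ^ (N ^ (d * n))) 0 (m + M) 1,
      ← Finset.range_eq_Ico, Finset.prod_range_add]
    congr 1
    refine Finset.prod_congr rfl fun k _ => ?_
    rw [← pow_mul, ← pow_add]
    ring_nf
  set c := ∏ n ∈ Finset.range m, (p (n + 1) : ℝ) ^ (N ^ (d * (n + 1))) with hc
  have hc0 : 0 < c := Finset.prod_pos fun n _ => pow_pos (hpos _ (by omega)) _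
  have h₁ := ((tendsto_add_atTop_iff_nat m).2 h).const_mul c⁻¹
  simp only [hprod, mul_zero, inv_mul_cancel_left₀ hc0.ne'] at h₁
  rw [tendsto_order] at h₁ ⊢
  refine ⟨fun a ha => Eventually.of_forall fun M => ha.trans_le
    (Finset.prod_nonneg fun k _ => pow_nonneg (p (m + k + 1)).2.1 _), fun a ha => ?_⟩
  filter_upwards [h₁.2 (a ^ N ^ (d * m)) (by positivity)] with M hM
  exact lt_of_pow_lt_pow_left₀ _ ha.le hM

theorem ae_interior_limitSet_eq_empty {N d : ℕ} (hN : 2 ≤ N) {p : ℕ → unitInterval}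
    (hpos : ∀ n, 1 ≤ n → 0 < (p n : ℝ))
    (h : InfiniteProductEq (fun n => (p n : ℝ) ^ (N ^ (d * n))) 0) :
    ∀ᵐ ω ∂(fatLaw N d p), interior (limitSet ω) = ∅ := by
  have hN' : 0 < N := by omega
  have key (a : Index N d) : ∀ᵐ ω ∂(fatLaw N d p), ¬ cube a.2 ⊆ limitSet ω := by
    obtain ⟨m, I⟩ := a
    rw [ae_iff]
    simp only [not_not]
    have hlim : Tendsto (fun M => ∏ k ∈ Finset.range M,
        ENNReal.ofReal (p (m + k + 1)) ^ (N ^ (d * (k + 1)))) atTop (𝓝 0) := by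
      rw [← ENNReal.ofReal_zero]
      refine (ENNReal.tendsto_ofReal (tendsto_prod_shift_zero hN' hpos h m)).congr fun M => ?_
      rw [ENNReal.ofReal_prod_of_nonneg fun k _ => pow_nonneg (p (m + k + 1)).2.1 _]
      exact Finset.prod_congr rfl fun k _ => ENNReal.ofReal_pow (p (m + k + 1)).2.1 _
    refine le_antisymm (ge_of_tendsto' hlim fun M => ?_) zero_le
    rw [← fatLaw_forall_append_eq_true p I M]
    exact measure_mono fun ω hω k _ W j => eq_true_of_cube_subset_limitSet hN' hω W j
  filter_upwards [ae_all_iff.2 key] with ω hω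
  by_contra hne
  obtain ⟨a, ha⟩ := exists_cube_subset_limitSet hN (Set.nonempty_iff_ne_empty.2 hne)
  exact hω a ha

/-! ### Part (ii): the dust set. -/

/-- The points of the unit slab in direction `t₀` whose line in this direction meets `C(I)`. -/
noncomputable def slab {N d n : ℕ} (t₀ : Fin d) (I : Word N d n) : Set (Fin d → ℝ) :=
  Set.Icc (Function.update (corner I) t₀ 0)
    (Function.update (fun t => corner I t + 1 / (N : ℝ) ^ n) t₀ 1)

theorem volume_slab {N d n : ℕ} (t₀ : Fin d) (I : Word N d n) :
    volume (slab t₀ I) = ENNReal.ofReal ((1 / (N : ℝ) ^ n) ^ (d - 1)) := by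
  rw [slab, Real.volume_Icc_pi, ← Finset.mul_prod_erase _ _ (Finset.mem_univ t₀),
    Finset.prod_congr rfl (g := fun _ => ENNReal.ofReal (1 / (N : ℝ) ^ n))]
  · rw [Finset.prod_const, Finset.card_erase_of_mem (Finset.mem_univ _), Finset.card_univ,
      Fintype.card_fin, ← ENNReal.ofReal_pow (by positivity)]
    simp
  · intro t ht
    simp [Function.update_of_ne (Finset.ne_of_mem_erase ht)]

theorem mem_slab {N d n : ℕ} {t₀ : Fin d} {I : Word N d n} {x y : Fin d → ℝ}
    (hx : x ∈ Set.Icc (0 : Fin d → ℝ) 1) (hxy : ∀ t, t ≠ t₀ → x t = y t) (hy : y ∈ cube I) :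
    x ∈ slab t₀ I := by
  rw [mem_cube] at hy
  constructor <;> intro t <;> rcases eq_or_ne t t₀ with rfl | ht
  · simpa using hx.1 t
  · simpa [ht, hxy t ht] using (hy t).1
  · simpa using hx.2 t
  · simpa [ht, hxy t ht] using (hy t).2

/-- A point of the limit set is not in the dust set if only finitely many discarded subcubes meet
its line in direction `t₀`. -/
theorem notMem_dust_of_finite {N d : ℕ} (hN : 0 < N) (t₀ : Fin d) {ω : Config N d}
    {x : Fin d → ℝ}
    (h : {a : Index N d × Digit N d | ω a = false ∧ x ∈ slab t₀ (child a.1.2 a.2)}.Finite) :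
    x ∉ dust ω := by
  rintro ⟨hxD, hcomp⟩
  obtain ⟨m, hm⟩ := (h.image fun a => a.1.1).bddAbove
  obtain ⟨I, hI, hxI⟩ := mem_stage.1 (mem_limitSet.1 hxD (m + 1) (by omega))
  have hP : (0 : ℝ) < 1 / (N : ℝ) ^ (m + 1) := by positivity
  -- `lo` and `hi` are the ends of the chord of `C(I)` through `x` in direction `t₀`; the box `[lo,
  -- hi]` degenerates to this chord.
  set lo : Fin d → ℝ := Function.update x t₀ (corner I t₀) with hlo
  set hi : Fin d → ℝ := Function.update x t₀ (corner I t₀ + 1 / (N : ℝ) ^ (m + 1)) with hhi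
  have hlohi : lo ≤ hi := by
    intro t
    rcases eq_or_ne t t₀ with rfl | ht
    · simp only [hlo, hhi, Function.update_self]
      linarith
    · simp [hlo, hhi, ht]
  have hxI' := mem_cube.1 hxI
  have hsub : Set.Icc lo hi ⊆ limitSet ω := by
    intro y hy
    have hxy : ∀ t, t ≠ t₀ → x t = y t := by
      intro t ht
      have h₁ := hy.1 t
      have h₂ := hy.2 t
      simp only [hlo, hhi, Function.update_of_ne ht] at h₁ h₂
      exact le_antisymm h₁ h₂
    have hyI : y ∈ cube I := by
      refine mem_cube.2 fun t => ?_
      rcases eq_or_ne t t₀ with rfl | ht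
      · have h₁ := hy.1 t
        have h₂ := hy.2 t
        simp only [hlo, hhi, Function.update_self] at h₁ h₂
        exact ⟨h₁, h₂⟩
      · rw [← hxy t ht]
        exact hxI' t
    refine mem_limitSet_of_forall_true hN (mem_stage.2 ⟨I, hI, hyI⟩) fun n hn J j hyJ => ?_
    by_contra hf
    have : n ≤ m := hm ⟨(⟨n, J⟩, j), ⟨by simpa using hf,
      mem_slab (cube_subset_unit hN I hxI) hxy hyJ⟩, rfl⟩
    omega
  have hxm : x ∈ Set.Icc lo hi := by
    constructor <;> intro t <;> rcases eq_or_ne t t₀ with rfl | ht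
    · simpa [hlo] using (hxI' t).1
    · simp [hlo, ht]
    · simpa [hhi] using (hxI' t).2
    · simp [hhi, ht]
  have hsingle := (convex_Icc lo hi).isPreconnected.subset_connectedComponentIn hxm hsub
  rw [hcomp] at hsingle
  have h₁ : lo = x := hsingle (Set.left_mem_Icc.2 hlohi)
  have h₂ : hi = x := hsingle (Set.right_mem_Icc.2 hlohi)
  have := congrFun (h₁.trans h₂.symm) t₀
  simp only [hlo, hhi, Function.update_self] at this
  linarith

theorem ae_volume_dust_eq_zero {N d : ℕ} (hN : 0 < N) (hd : 0 < d) {p : ℕ → unitInterval} {L : ℝ}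
    (hL : 0 < L) (h : InfiniteProductEq (fun n => (p n : ℝ) ^ (N ^ n)) L) :
    ∀ᵐ ω ∂(fatLaw N d p), volume (dust ω) = 0 := by
  let t₀ : Fin d := ⟨0, hd⟩
  let v (a : Index N d × Digit N d) : ENNReal := volume (slab t₀ (child a.1.2 a.2))
  let F (a : Index N d × Digit N d) : Config N d → ENNReal :=
    Set.indicator {ω | ω a = false} fun _ => v a
  have hF (a) : Measurable (F a) := measurable_const.indicator (measurableSet_eq_false a)
  -- Tonelli: the expected total volume of the slabs of failed cubes.
  have hint : ∫⁻ ω, ∑' a, F a ω ∂(fatLaw N d p) ≠ ⊤ := by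
    rw [lintegral_tsum fun a => (hF a).aemeasurable]
    simp only [F, lintegral_indicator_const (measurableSet_eq_false _), fatLaw_eq_false, v,
      volume_slab]
    rw [tsum_index_digit N d (fun n => ENNReal.ofReal ((1 / (N : ℝ) ^ n) ^ (d - 1)) *
      ENNReal.ofReal (1 - p n))]
    convert (summable_of_infiniteProductEq_pos hL h).tsum_ofReal_ne_top using 3 with n
    rw [← ENNReal.ofReal_natCast, ← ENNReal.ofReal_mul (by positivity),
      ← ENNReal.ofReal_mul (by positivity), ← mul_assoc]
    congr 2
    -- The exponents combine as `N^{d(n+1)} · N^{-(n+1)(d-1)} = N^{n+1}`.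
    obtain ⟨e, rfl⟩ : ∃ e, d = e + 1 := ⟨d - 1, by omega⟩
    have hN' : (N : ℝ) ≠ 0 := by exact_mod_cast hN.ne'
    push_cast
    rw [one_div, inv_pow, ← pow_mul, ← div_eq_mul_inv,
      div_eq_iff (pow_ne_zero _ hN'), ← pow_add]
    ring
  filter_upwards [ae_lt_top (Measurable.tsum hF) hint] with ω hω
  have hsum : ∑' a, volume {x | ω a = false ∧ x ∈ slab t₀ (child a.1.2 a.2)} ≠ ⊤ := by
    refine ne_of_eq_of_ne (tsum_congr fun a => ?_) hω.ne
    by_cases ha : ω a = false <;> simp [F, v, ha]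
  -- Borel–Cantelli again, now for Lebesgue measure in `x` with `ω` fixed. The dust lies in the
  -- exceptional null set, so its measurability is not needed.
  have hfin := ae_finite_setOfPred_mem hsum
  exact measure_mono_null (fun x hx hx' => notMem_dust_of_finite hN t₀ hx' hx) (ae_iff.1 hfin)

end FatFractal

theorem theorem5 (N d : ℕ) (hN : 2 ≤ N) (hd : 2 ≤ d) (p : ℕ → unitInterval)
    (hpos : ∀ n, 1 ≤ n → 0 < (p n : ℝ))
    (hmono : ∀ m n, 1 ≤ m → m ≤ n → (p m : ℝ) ≤ (p n : ℝ))
    (hprod : ∃ L : ℝ, 0 < L ∧ FatFractal.InfiniteProductEq (fun n => (p n : ℝ)) L) :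
    (FatFractal.InfiniteProductEq (fun n => (p n : ℝ) ^ (N ^ (d * n))) 0 →
      ∀ᵐ ω ∂(FatFractal.fatLaw N d p), interior (FatFractal.limitSet ω) = ∅) ∧
    ((∃ L : ℝ, 0 < L ∧ FatFractal.InfiniteProductEq (fun n => (p n : ℝ) ^ (N ^ n)) L) →
      ∀ᵐ ω ∂(FatFractal.fatLaw N d p), volume (FatFractal.dust ω) = 0) ∧
    ((∃ L : ℝ, 0 < L ∧ FatFractal.InfiniteProductEq (fun n => (p n : ℝ) ^ (N ^ (d * n))) L) →
      ∀ᵐ ω ∂(FatFractal.fatLaw N d p), ∃ S : Finset (FatFractal.Index N d),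
        FatFractal.limitSet ω = ⋃ I ∈ S, FatFractal.cube I.2) := by
  refine ⟨FatFractal.ae_interior_limitSet_eq_empty hN hpos, ?_, ?_⟩
  · rintro ⟨L, hL, h⟩
    exact FatFractal.ae_volume_dust_eq_zero (by omega) (by omega) hL h
  · rintro ⟨L, hL, h⟩
    exact FatFractal.ae_exists_limitSet_eq_iUnion_cube (by omega) hL h
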